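/- Let $n,d\ge 1$ be integers. Let $P_{n,2d}$ be the space of real homogeneous polynomials of degree $2d$ in $n$ variables, let $\sigma$ be the uniform probability measure on the unit sphere $S^{n-1}\subset\mathbb R^n$, and equip $P_{n,2d}$ with the inner product $\langle f,g\rangle=\int_{S^{n-1}}fg\,d\sigma$. Put $r=(x_1^2+\dots+x_n^2)^d\in P_{n,2d}$ and $$\widetilde{Pos}_{n,2d}=\Big\{f\in P_{n,2d}: f(x)\ge 0\ \text{for all } x\in S^{n-1},\ \int_{S^{n-1}}f\,d\sigma=1\Big\}.$$ For $v\in S^{n-1}$ let $p_v\in P_{n,2d}$ be the unique form with $\langle f,p_v\rangle=f(v)$ for all $f\in P_{n,2d}$, and let $B=\operatorname{conv}\{p_v-r: v\in S^{n-1}\}$ be the body of point evaluations. A polytope is the convex hull of a finite set, and a facet of a polytope $K$ is a face of dimension $\dim K-1$, where the empty set counts as a face of dimension $-1$. There are absolute constants $a_0,a_1>0$ (independent of $n$, $d$ and $c$) such that for all integers $n,d\ge 1$ and every real $c>1$ the following two statements hold. 1. Every polytope $K\subset P_{n,2d}$ with $$\widetilde{Pos}_{n,2d}-r\ \subseteq\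 K\ \subseteq\ c^d\big(\widetilde{Pos}_{n,2d}-r\big)$$ has at least $a_0\exp\!\big(a_1\frac{n}{cd}\big)$ facets. 2. If $f_1,\dots,f_N\in P_{n,2d}$ and the polytope $P=\operatorname{conv}\{f_1,\dots,f_N\}$ satisfies $B\subseteq P\subseteq c^d B$, then $P$ has at least $a_0\exp\!\big(a_1\frac{n}{cd}\big)$ vertices; in particular $N\ge a_0\exp\!\big(a_1\frac{n}{cd}\big)$. -/

import Mathlib

open MeasureTheory
open scoped Pointwise

namespace NonnegForms

noncomputable section

/-- The unit sphere `S^{n-1}` of Euclidean space `ℝⁿ`. -/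
abbrev UnitSphere (n : ℕ) : Type :=
  Metric.sphere (0 : EuclideanSpace ℝ (Fin n)) 1

/-- The uniform (rotation invariant) probability measure on `S^{n-1}`, `n ≥ 1`: the normalized
surface measure. -/
def sphereUniform (n : ℕ) : Measure (UnitSphere n) :=
  ((volume : Measure (EuclideanSpace ℝ (Fin n))).toSphere Set.univ)⁻¹ •
    (volume : Measure (EuclideanSpace ℝ (Fin n))).toSphere

/-- The space `P_{n,2d}` of real forms of degree `2d` in `n` variables. -/
abbrev Form (n d : ℕ) : Type :=
  MvPolynomial.homogeneousSubmodule (Fin n) ℝ (2 * d)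

/-- The value `f(v)` of a form at a point of the sphere. -/
def evalAt {n d : ℕ} (f : Form n d) (v : UnitSphere n) : ℝ :=
  MvPolynomial.eval (fun i => (v : EuclideanSpace ℝ (Fin n)) i) (f : MvPolynomial (Fin n) ℝ)

/-- The form `r = (x₁² + ⋯ + xₙ²)^d`. -/
def radial (n d : ℕ) : Form n d :=
  ⟨(∑ i : Fin n, MvPolynomial.X i ^ 2) ^ d,
    (MvPolynomial.mem_homogeneousSubmodule _ _).2
      ((MvPolynomial.IsHomogeneous.sum Finset.univ
        (fun i : Fin n => (MvPolynomial.X i : MvPolynomial (Fin n) ℝ) ^ 2) 2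
        (fun i _ => MvPolynomial.isHomogeneous_X_pow i 2)).pow d)⟩

/-- The cone `Pos_{n,2d}` of forms that are nonnegative on the sphere. -/
def posCone (n d : ℕ) : Set (Form n d) :=
  {f | ∀ v : UnitSphere n, 0 ≤ evalAt f v}

/-- The base of `Pos_{n,2d}` that consists of the forms with mean `1` on the sphere. -/
def posBase (n d : ℕ) : Set (Form n d) :=
  {f | f ∈ posCone n d ∧ ∫ v, evalAt f v ∂(sphereUniform n) = 1}

/-- The inner product `⟨f, g⟩ = ∫ f g dσ` on `P_{n,2d}`. -/
def sphereInner {n d : ℕ} (f g : Form n d) : ℝ :=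
  ∫ v, evalAt f v * evalAt g v ∂(sphereUniform n)

/-- `p` is the form `p_v` that represents evaluation at `v`: `⟨f, p⟩ = f(v)` for all `f`. -/
def IsEvalForm {n d : ℕ} (v : UnitSphere n) (p : Form n d) : Prop :=
  ∀ f : Form n d, sphereInner f p = evalAt f v

/-- The body of point evaluations `B = conv {p_v - r : v ∈ S^{n-1}}`. -/
def evalBody (n d : ℕ) : Set (Form n d) :=
  convexHull ℝ {q | ∃ (v : UnitSphere n) (p : Form n d), IsEvalForm v p ∧ q = p - radial n d}

section Polytopes

variable {V : Type*} [AddCommGroup V] [Module ℝ V]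

/-- A polytope: the convex hull of finitely many points. -/
def IsPolytope (K : Set V) : Prop :=
  ∃ s : Finset V, K = convexHull ℝ (s : Set V)

/-- A face of `K`: the points of `K` at which a linear inequality `l ≤ b` that is valid on `K` is
an equality. The empty set and `K` itself are faces. -/
def IsFace (K F : Set V) : Prop :=
  ∃ (l : V →ₗ[ℝ] ℝ) (b : ℝ), (∀ x ∈ K, l x ≤ b) ∧ F = {x | x ∈ K ∧ l x = b}

open Classical in
/-- The affine dimension of a set (in a finite-dimensional space), with `dim ∅ = -1`. -/
def affineDim (S : Set V) : ℤ :=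
  if S = ∅ then -1 else (Module.finrank ℝ (vectorSpan ℝ S) : ℤ)

/-- A facet of `K`: a face of dimension `dim K - 1`. -/
def IsFacet (K F : Set V) : Prop :=
  IsFace K F ∧ affineDim F = affineDim K - 1

/-- The number of facets of a polytope. -/
def numFacets (K : Set V) : ℕ :=
  {F : Set V | IsFacet K F}.ncard

/-- The number of vertices of a polytope. -/
def numVertices (K : Set V) : ℕ :=
  (Set.extremePoints ℝ K).ncard

end Polytopes

/-! The forms `p_v` exist and are unique. -/

instance instFiniteForm (n d : ℕ) : Module.Finite ℝ (Form n d) :=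
  Module.Finite.iff_fg.2 (MvPolynomial.homogeneousSubmodule_fg (Fin n) ℝ (2 * d))

theorem isProbabilityMeasure_sphereUniform (n : ℕ) (hn : 1 ≤ n) :
    IsProbabilityMeasure (sphereUniform n) := by
  have : Nonempty (Fin n) := ⟨⟨0, hn⟩⟩
  constructor
  simp only [sphereUniform, Measure.smul_apply, smul_eq_mul]
  refine ENNReal.inv_mul_cancel ?_ (measure_ne_top _ _)
  rw [Ne, Measure.measure_univ_eq_zero]
  exact Measure.toSphere_ne_zero _

theorem continuous_evalAt {n d : ℕ} (f : Form n d) : Continuous (evalAt f) := by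
  unfold evalAt
  exact (MvPolynomial.continuous_eval (f : MvPolynomial (Fin n) ℝ)).comp (by fun_prop)

theorem integrable_of_continuous {n : ℕ} (hn : 1 ≤ n) {g : UnitSphere n → ℝ}
    (hg : Continuous g) : Integrable g (sphereUniform n) := by
  have := isProbabilityMeasure_sphereUniform n hn
  exact hg.integrable_of_hasCompactSupport (HasCompactSupport.of_compactSpace g)

theorem eval_smul_of_isHomogeneous {n m : ℕ} {F : MvPolynomial (Fin n) ℝ}
    (hF : F.IsHomogeneous m) (c : ℝ) (x : Fin n → ℝ) :
    MvPolynomial.eval (fun i => c * x i) F = c ^ m * MvPolynomial.eval x F := by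
  rw [MvPolynomial.eval_eq', MvPolynomial.eval_eq', Finset.mul_sum]
  refine Finset.sum_congr rfl fun e he => ?_
  have hdeg : ∑ i, e i = m := by
    have h := hF (MvPolynomial.mem_support_iff.1 he)
    rw [Finsupp.weight_apply, Finsupp.sum_fintype _ _ (by simp)] at h
    simpa using h
  simp only [mul_pow, Finset.prod_mul_distrib, Finset.prod_pow_eq_pow_sum, hdeg]
  ring

theorem eq_zero_of_evalAt {n d : ℕ} (hn : 1 ≤ n) (f : Form n d) (h : ∀ v, evalAt f v = 0) :
    f = 0 := by
  have : Nonempty (Fin n) := ⟨⟨0, hn⟩⟩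
  have hf := (MvPolynomial.mem_homogeneousSubmodule _ _).1 f.2
  have key : ∀ (c : ℝ) (v : UnitSphere n),
      MvPolynomial.eval (fun i => c * (v : EuclideanSpace ℝ (Fin n)) i)
        (f : MvPolynomial (Fin n) ℝ) = 0 := by
    intro c v
    rw [eval_smul_of_isHomogeneous hf]
    have := h v
    unfold evalAt at this
    rw [this, mul_zero]
  apply Subtype.ext
  refine MvPolynomial.funext fun x => ?_
  have hx : ∃ (c : ℝ) (v : UnitSphere n),
      x = fun i => c * (v : EuclideanSpace ℝ (Fin n)) i := by
    by_cases h0 : WithLp.toLp 2 x = (0 : EuclideanSpace ℝ (Fin n))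
    · obtain ⟨v⟩ : Nonempty (UnitSphere n) :=
        (NormedSpace.sphere_nonempty.2 zero_le_one).to_subtype
      refine ⟨0, v, ?_⟩
      funext i
      have := congrArg (fun y : EuclideanSpace ℝ (Fin n) => y i) h0
      simpa using this
    · have hne : ‖(WithLp.toLp 2 x : EuclideanSpace ℝ (Fin n))‖ ≠ 0 := norm_ne_zero_iff.2 h0
      refine ⟨‖(WithLp.toLp 2 x : EuclideanSpace ℝ (Fin n))‖,
        ⟨‖(WithLp.toLp 2 x : EuclideanSpace ℝ (Fin n))‖⁻¹ • WithLp.toLp 2 x, ?_⟩, ?_⟩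
      · rw [mem_sphere_zero_iff_norm, norm_smul, norm_inv, norm_norm, inv_mul_cancel₀ hne]
      · funext i
        simp [hne]
  obtain ⟨c, v, rfl⟩ := hx
  simpa using key c v

theorem evalAt_add {n d : ℕ} (f g : Form n d) (v : UnitSphere n) :
    evalAt (f + g) v = evalAt f v + evalAt g v := by
  simp [evalAt]

theorem evalAt_smul {n d : ℕ} (a : ℝ) (f : Form n d) (v : UnitSphere n) :
    evalAt (a • f) v = a * evalAt f v := by
  simp [evalAt]

theorem eq_zero_of_sphereInner_self {n d : ℕ} (hn : 1 ≤ n) (f : Form n d)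
    (h : sphereInner f f = 0) : f = 0 := by
  have : Nonempty (Fin n) := ⟨⟨0, hn⟩⟩
  have hc : Continuous fun v => evalAt f v * evalAt f v :=
    (continuous_evalAt f).mul (continuous_evalAt f)
  have : (sphereUniform n).IsOpenPosMeasure := by
    unfold sphereUniform
    exact Measure.isOpenPosMeasure_smul _ (ENNReal.inv_ne_zero.2 (measure_ne_top _ _))
  unfold sphereInner at h
  rw [integral_eq_zero_iff_of_nonneg (fun v => mul_self_nonneg _)
    (integrable_of_continuous hn hc)] at h
  have h' := Continuous.ae_eq_iff_eq (sphereUniform n) hc continuous_const |>.1 h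
  exact eq_zero_of_evalAt hn f fun v => mul_self_eq_zero.1 (congrFun h' v)

theorem existsUnique_evalForm {n d : ℕ} (hn : 1 ≤ n) (v : UnitSphere n) :
    ∃! p : Form n d, IsEvalForm v p := by
  have hint : ∀ f g : Form n d,
      Integrable (fun v => evalAt f v * evalAt g v) (sphereUniform n) := fun f g =>
    integrable_of_continuous hn ((continuous_evalAt f).mul (continuous_evalAt g))
  let T : Form n d →ₗ[ℝ] Module.Dual ℝ (Form n d) :=
    LinearMap.mk₂ ℝ (fun p f => sphereInner f p)
      (fun p q f => by
        simp only [sphereInner, evalAt_add, mul_add]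
        exact integral_add (hint f p) (hint f q))
      (fun a p f => by
        simp only [sphereInner, evalAt_smul, smul_eq_mul]
        rw [← integral_const_mul]
        congr 1
        funext w
        ring)
      (fun p f g => by
        simp only [sphereInner, evalAt_add, add_mul]
        exact integral_add (hint f p) (hint g p))
      (fun a p f => by
        simp only [sphereInner, evalAt_smul, smul_eq_mul]
        rw [← integral_const_mul]
        congr 1
        funext w
        ring)
  have hT : Function.Injective T := by
    rw [injective_iff_map_eq_zero]
    intro p hp
    exact eq_zero_of_sphereInner_self hn p (LinearMap.congr_fun hp p)
  have hS : Function.Surjective T :=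
    (LinearMap.injective_iff_surjective_of_finrank_eq_finrank
      Subspace.dual_finrank_eq.symm).1 hT
  let l : Module.Dual ℝ (Form n d) :=
    { toFun := fun f => evalAt f v
      map_add' := fun f g => evalAt_add f g v
      map_smul' := fun a f => evalAt_smul a f v }
  obtain ⟨p, hp⟩ := hS l
  refine ⟨p, fun f => LinearMap.congr_fun hp f, fun q hq => hT ?_⟩
  rw [hp]
  exact LinearMap.ext hq

end

end NonnegForms

open NonnegForms

namespace NonnegForms

/-! ### Faces and facets of polytopes given by finitely many points. -/

section Polytopes

variable {V : Type*} [AddCommGroup V] [Module ℝ V]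

/-! The test forms are q_e = (±x₁ ± ⋯ ± xₙ)^{2d}, one for each sign vector e. Each q_e takes the
value n^d on the sphere, but at a fixed point few of them are large: by Khintchine's inequality the
average of q_e(v)^k over e is at most 2(2dk·exp 1)^{dk}. Young's inequality extends this bound from
point evaluations to every functional L that is nonnegative on the cone with L(r) = 1
(`sum_pow_signForm_le`). If each q_e has L(q_e) ≥ (n/c)^d for some L in a finite family, summing
moments and taking k near n/(2(exp 1)²cd) makes the family exponentially large (`exp_le_card`).

Both statements produce such a family by `liftFunctional`. A facet l = 1 of K gives f ↦ ∫f - l(f -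
(∫f)r); a vertex g of P gives f ↦ ∫f + c^{-d}⟨g, f - (∫f)r⟩. One inclusion of each sandwich gives
positivity. The other, at a point v with q_e(v) = n^d, gives the large value: the inequality given
by -c^{-d} times evaluation at v is valid on K and can be moved to a facet (`exists_tight_span`),
while p_v - r lies in P, so some vertex does at least as well. -/

theorem le_of_mem_convexHull {S : Set V} {l : V →ₗ[ℝ] ℝ} {b : ℝ} (h : ∀ x ∈ S, l x ≤ b)
    {x : V} (hx : x ∈ convexHull ℝ S) : l x ≤ b :=
  convexHull_min (t := {x | l x ≤ b}) h (convex_halfSpace_le l.isLinear b) hx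

/-- A linear functional that exceeds a bound somewhere on a convex hull exceeds it at a
generator. -/
theorem exists_le_of_mem_convexHull {S : Set V} {l : V →ₗ[ℝ] ℝ} {b : ℝ} {x : V}
    (hx : x ∈ convexHull ℝ S) (hb : b ≤ l x) : ∃ e ∈ S, b ≤ l e := by
  by_contra! h
  exact (convexHull_min (t := {x | l x < b}) h (convex_halfSpace_lt l.isLinear b) hx).not_ge hb

/-- A finite-dimensional polytope is the convex hull of its extreme points. -/
theorem convexHull_extremePoints_of_finite [FiniteDimensional ℝ V] {S : Set V} (hS : S.Finite) :
    convexHull ℝ (Set.extremePoints ℝ (convexHull ℝ S)) = convexHull ℝ S := by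
  -- A norm pulled back from coordinates makes the Krein–Milman theorem available.
  let e := (Module.finBasis ℝ V).equivFun
  let _ : NormedAddCommGroup V := NormedAddCommGroup.induced V _ e e.injective
  let _ : NormedSpace ℝ V := NormedSpace.induced ℝ V _ e
  have hfin : (Set.extremePoints ℝ (convexHull ℝ S)).Finite :=
    hS.subset extremePoints_convexHull_subset
  have h := closure_convexHull_extremePoints (Set.Finite.isCompact_convexHull ℝ hS) (convex_convexHull ℝ S)
  rwa [(Set.Finite.isClosed_convexHull ℝ hfin).closure_eq] at h

/-- In a convex combination on which the inequality is tight, the nonnegative slacks average to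
zero, so only tight generators carry weight. -/
theorem face_eq_convexHull (s : Finset V) {l : V →ₗ[ℝ] ℝ} {b : ℝ} (h : ∀ x ∈ s, l x ≤ b) :
    {x | x ∈ convexHull ℝ (s : Set V) ∧ l x = b}
      = convexHull ℝ (s.filter (fun x => l x = b) : Set V) := by
  classical
  apply Set.Subset.antisymm
  · rintro x ⟨hx, hb⟩
    rw [Finset.mem_convexHull'] at hx ⊢
    obtain ⟨w, hw0, hw1, rfl⟩ := hx
    have hsum : ∑ y ∈ s, w y * (b - l y) = 0 := by
      simp only [map_sum, map_smul, smul_eq_mul] at hb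
      simp only [mul_sub, Finset.sum_sub_distrib, ← Finset.sum_mul, hw1, hb]
      ring
    have hz := (Finset.sum_eq_zero_iff_of_nonneg
      (fun y hy => mul_nonneg (hw0 y hy) (sub_nonneg.2 (h y hy)))).1 hsum
    have hz' : ∀ y ∈ s, ¬ l y = b → w y = 0 := fun y hy hne =>
      (mul_eq_zero.1 (hz y hy)).resolve_right fun h0 => hne (by linarith)
    refine ⟨w, fun y hy => hw0 y (Finset.mem_of_mem_filter y hy), ?_, ?_⟩
    · rw [← hw1]
      refine Finset.sum_subset (Finset.filter_subset _ _) fun y hy hn => hz' y hy fun hb' => ?_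
      exact hn (Finset.mem_filter.2 ⟨hy, hb'⟩)
    · refine Finset.sum_subset (Finset.filter_subset _ _) fun y hy hn => ?_
      rw [hz' y hy fun hb' => hn (Finset.mem_filter.2 ⟨hy, hb'⟩), zero_smul]
  · refine convexHull_min (fun x hx => ?_)
      ((convex_convexHull ℝ _).inter (convex_hyperplane l.isLinear b))
    have hx := Finset.mem_filter.1 (Finset.mem_coe.1 hx)
    exact ⟨subset_convexHull ℝ _ (Finset.mem_coe.2 hx.1), hx.2⟩

/-- A face is determined by the generators on it. Finiteness matters because `numFacets` is an
`ncard`, which is 0 on infinite sets. -/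
theorem finite_setOf_isFacet {K : Set V} (hK : IsPolytope K) : {F | IsFacet K F}.Finite := by
  classical
  obtain ⟨s, rfl⟩ := hK
  refine (s.powerset.finite_toSet.image
    fun t : Finset V => convexHull ℝ (t : Set V)).subset ?_
  rintro F ⟨⟨l, b, hl, rfl⟩, -⟩
  refine ⟨s.filter (fun x => l x = b), ?_, ?_⟩
  · exact Finset.mem_coe.2 (Finset.mem_powerset.2 (Finset.filter_subset _ _))
  exact (face_eq_convexHull s fun x hx => hl x (subset_convexHull ℝ _ hx)).symm

/-- If `0` is a relative interior point of the convex hull of `s`, a valid inequality `l ≤ 1` can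
be moved, without decreasing its value at a given point `y`, until it is tight on a spanning subset
of `s`. -/
theorem exists_tight_span (s : Finset V)
    (habs : ∀ φ : V →ₗ[ℝ] ℝ, (∀ x ∈ s, φ x ≤ 0) → ∀ x ∈ s, φ x = 0) (y : V)
    (l : V →ₗ[ℝ] ℝ) (hl : ∀ x ∈ s, l x ≤ 1) :
    ∃ l' : V →ₗ[ℝ] ℝ, (∀ x ∈ s, l' x ≤ 1) ∧ l y ≤ l' y ∧
      ∀ x ∈ s, x ∈ Submodule.span ℝ {x | x ∈ s ∧ l' x = 1} := by
  classical
  -- While the tight points do not span, some φ vanishes on them but not on all of s. Moving l along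
  -- φ keeps them tight and gains a new one.
  induction hm : (s.filter fun x => l x ≠ 1).card using Nat.strong_induction_on generalizing l with
  | _ m ih =>
  by_cases hsp : ∀ x ∈ s, x ∈ Submodule.span ℝ {x | x ∈ s ∧ l x = 1}
  · exact ⟨l, hl, le_rfl, hsp⟩
  push Not at hsp
  obtain ⟨x₀, hx₀, hx₀n⟩ := hsp
  obtain ⟨φ, hφ0, hφ⟩ : ∃ φ : V →ₗ[ℝ] ℝ, φ x₀ ≠ 0 ∧
      ∀ x ∈ s, l x = 1 → φ x = 0 := by
    obtain ⟨φ, h1, h2⟩ := Submodule.exists_le_ker_of_notMem hx₀n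
    exact ⟨φ, h1, fun x hx hlx => h2 (Submodule.subset_span ⟨hx, hlx⟩)⟩
  obtain ⟨φ, hφ0, hφ, hφy⟩ : ∃ φ : V →ₗ[ℝ] ℝ, φ x₀ ≠ 0 ∧
      (∀ x ∈ s, l x = 1 → φ x = 0) ∧ 0 ≤ φ y := by
    rcases le_total 0 (φ y) with h | h
    · exact ⟨φ, hφ0, hφ, h⟩
    · exact ⟨-φ, by simpa using hφ0, fun x hx hlx => by simp [hφ x hx hlx], by simpa using h⟩
  -- Since φ is nonzero on s, `habs` forces a positive value, so the motion along φ must stop; the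
  -- minimal ratio below is the time at which it does.
  have hne : (s.filter fun x => 0 < φ x).Nonempty := by
    by_contra hemp
    rw [Finset.not_nonempty_iff_eq_empty, Finset.filter_eq_empty_iff] at hemp
    exact hφ0 (habs φ (fun x hx => not_lt.1 (hemp hx)) x₀ hx₀)
  obtain ⟨z, hz, hmin⟩ := Finset.exists_min_image _ (fun x => (1 - l x) / φ x) hne
  obtain ⟨hzs, hzφ⟩ := Finset.mem_filter.1 hz
  have ht : 0 ≤ (1 - l z) / φ z := div_nonneg (sub_nonneg.2 (hl z hzs)) hzφ.le
  set t := (1 - l z) / φ z with ht_def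
  have hl' : ∀ x ∈ s, (l + t • φ) x ≤ 1 := by
    intro x hx
    simp only [LinearMap.add_apply, LinearMap.smul_apply, smul_eq_mul]
    rcases lt_or_ge 0 (φ x) with hp | hp
    · have := hmin x (Finset.mem_filter.2 ⟨hx, hp⟩)
      rw [le_div_iff₀ hp] at this
      linarith
    · nlinarith [hl x hx, mul_nonneg ht (neg_nonneg.2 hp)]
  have hlt : (s.filter fun x => (l + t • φ) x ≠ 1).card < m := by
    rw [← hm]
    refine Finset.card_lt_card (Finset.ssubset_iff_of_subset ?_ |>.2 ⟨z, ?_, ?_⟩)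
    · intro x hx
      obtain ⟨hxs, hx1⟩ := Finset.mem_filter.1 hx
      refine Finset.mem_filter.2 ⟨hxs, fun h => hx1 ?_⟩
      simp [h, hφ x hxs h]
    · exact Finset.mem_filter.2 ⟨hzs, fun h => hzφ.ne' (hφ z hzs h)⟩
    · simp only [Finset.mem_filter, not_and, not_not]
      intro _
      simp only [LinearMap.add_apply, LinearMap.smul_apply, smul_eq_mul, ht_def]
      field_simp
      ring
  obtain ⟨l'', h1, h2, h3⟩ := ih _ hlt (l + t • φ) hl' rfl
  refine ⟨l'', h1, le_trans ?_ h2, h3⟩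
  simp only [LinearMap.add_apply, LinearMap.smul_apply, smul_eq_mul]
  nlinarith [mul_nonneg ht hφy]

/-- The tight points span the same subspace as K. The directions of the face lie in the kernel of l,
and any one point of the face lies outside it, so adjoining that point raises the dimension by
exactly one. -/
theorem isFacet_of_tight_span [FiniteDimensional ℝ V] (s : Finset V)
    (h0 : (0 : V) ∈ convexHull ℝ (s : Set V)) {l : V →ₗ[ℝ] ℝ} (hl : ∀ x ∈ s, l x ≤ 1)
    (hs : ∀ x ∈ s, x ∈ Submodule.span ℝ {x | x ∈ s ∧ l x = 1}) :
    IsFacet (convexHull ℝ (s : Set V)) {x | x ∈ convexHull ℝ (s : Set V) ∧ l x = 1} := by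
  refine ⟨⟨l, 1, fun x hx => le_of_mem_convexHull hl hx, rfl⟩, ?_⟩
  set K := convexHull ℝ (s : Set V) with hK
  set F := {x | x ∈ K ∧ l x = 1} with hF
  have hKsub : ∀ (W : Submodule ℝ V), (∀ x ∈ s, l x = 1 → x ∈ W) → K ⊆ W := by
    intro W hW
    refine convexHull_min (fun x hx => ?_) W.convex
    exact Submodule.span_le.2 (fun y hy => hW y hy.1 hy.2) (hs x hx)
  have hsF : ∀ x ∈ s, l x = 1 → x ∈ F := fun x hx h => ⟨subset_convexHull ℝ _ hx, h⟩
  have hKne : K ≠ ∅ := Set.Nonempty.ne_empty ⟨0, h0⟩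
  have hvK : vectorSpan ℝ K = Submodule.span ℝ K := by
    simp [vectorSpan_eq_span_vsub_set_right ℝ h0]
  have hfr : Module.finrank ℝ (vectorSpan ℝ K) = Module.finrank ℝ (Submodule.span ℝ K) := by
    rw [hvK]
  -- An empty face forces K = {0}; then the empty set, of dimension -1, is indeed a facet.
  rcases Set.eq_empty_or_nonempty F with hFe | ⟨x₀, hx₀⟩
  · have hK0 : Submodule.span ℝ K = ⊥ := by
      rw [eq_bot_iff, Submodule.span_le]
      refine hKsub ⊥ fun x hx h => ?_
      have := hsF x hx h
      rw [hFe] at this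
      exact this.elim
    rw [hK0, finrank_bot] at hfr
    simp [affineDim, hFe, hKne, hfr]
  · have hFne : F ≠ ∅ := Set.Nonempty.ne_empty ⟨x₀, hx₀⟩
    have hsup : vectorSpan ℝ F ⊔ Submodule.span ℝ {x₀} = Submodule.span ℝ K := by
      apply le_antisymm
      · refine sup_le ?_ ?_
        · rw [← hvK]
          exact vectorSpan_mono ℝ fun x hx => hx.1
        · rw [Submodule.span_singleton_le_iff_mem]
          exact Submodule.subset_span hx₀.1
      · rw [Submodule.span_le]
        refine hKsub _ fun x hx h => ?_
        have : x = (x -ᵥ x₀) + x₀ := by simp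
        rw [this]
        exact Submodule.add_mem_sup (vsub_mem_vectorSpan ℝ (hsF x hx h) hx₀)
          (Submodule.mem_span_singleton_self x₀)
    have hker : vectorSpan ℝ F ≤ LinearMap.ker l := by
      rw [vectorSpan_eq_span_vsub_set_right ℝ hx₀, Submodule.span_le]
      rintro _ ⟨x, hx, rfl⟩
      simp [hx.2, hx₀.2]
    have hinf : vectorSpan ℝ F ⊓ Submodule.span ℝ {x₀} = ⊥ := by
      rw [eq_bot_iff]
      rintro x ⟨hx1, hx2⟩
      obtain ⟨a, rfl⟩ := Submodule.mem_span_singleton.1 hx2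
      have h1 : l (a • x₀) = 0 := hker hx1
      rw [map_smul, hx₀.2, smul_eq_mul, mul_one] at h1
      simp [h1]
    have hx₀0 : x₀ ≠ 0 := fun h => by simpa [h] using hx₀.2
    have hdim := Submodule.finrank_sup_add_finrank_inf_eq (vectorSpan ℝ F)
      (Submodule.span ℝ {x₀})
    rw [hsup, hinf, finrank_bot, finrank_span_singleton hx₀0] at hdim
    simp only [affineDim, hKne, hFne, if_false, hfr]
    omega

end Polytopes

end NonnegForms

namespace NonnegForms

/-! ### Moments of sign sums -/

/-- The sign `±1` that a Boolean encodes. -/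
def boolSign (b : Bool) : ℝ := if b then 1 else -1

theorem sum_exp_sign_sum {n : ℕ} (x : Fin n → ℝ) :
    ∑ e : Fin n → Bool, Real.exp (∑ i, boolSign (e i) * x i) = 2 ^ n * ∏ i, Real.cosh (x i) := by
  have h := Finset.prod_univ_sum (fun _ : Fin n => (Finset.univ : Finset Bool))
    (fun i b => Real.exp (boolSign b * x i))
  rw [Fintype.piFinset_univ] at h
  simp only [Real.exp_sum]
  rw [← h]
  have : ∀ i, ∑ b : Bool, Real.exp (boolSign b * x i) = 2 * Real.cosh (x i) := by
    intro i
    rw [Real.cosh_eq]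
    simp [boolSign]
    ring
  simp only [this, Finset.prod_mul_distrib, Finset.prod_const, Finset.card_univ,
    Fintype.card_fin]

theorem sum_exp_sign_sum_le {n : ℕ} (x : Fin n → ℝ) :
    ∑ e : Fin n → Bool, Real.exp (∑ i, boolSign (e i) * x i)
      ≤ 2 ^ n * Real.exp ((∑ i, x i ^ 2) / 2) := by
  rw [sum_exp_sign_sum, Finset.sum_div, Real.exp_sum]
  gcongr with i
  exact Real.cosh_le_exp_half_sq _

/-- Khintchine's inequality for even moments, on the unit sphere. -/
theorem sum_sign_sum_pow_le {n M : ℕ} (hM : 1 ≤ M) (x : Fin n → ℝ) (hx : ∑ i, x i ^ 2 = 1) :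
    ∑ e : Fin n → Bool, (∑ i, boolSign (e i) * x i) ^ (2 * M)
      ≤ 2 ^ n * (2 * (2 * M * Real.exp 1) ^ M) := by
  have hM0 : (0 : ℝ) < 2 * M := by positivity
  -- This t bounds the exponential moment by (exp 1)^M, and t^{2M} = (2M)^M cancels half of the
  -- bound (2M)^{2M} for the factorial.
  set t := Real.sqrt (2 * M) with ht
  have ht2 : t ^ 2 = 2 * M := Real.sq_sqrt hM0.le
  have ht2M : t ^ (2 * M) = (2 * M : ℝ) ^ M := by rw [pow_mul, ht2]
  have hone : ∀ y : ℝ, (t * y) ^ (2 * M)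
      ≤ (2 * M : ℝ) ^ (2 * M) * (Real.exp (t * y) + Real.exp (-(t * y))) := by
    intro y
    have h1 := Real.pow_div_factorial_le_exp |t * y| (abs_nonneg _) (2 * M)
    rw [div_le_iff₀ (by positivity), (even_two_mul M).pow_abs] at h1
    have h2 : Real.exp |t * y| ≤ Real.exp (t * y) + Real.exp (-(t * y)) := by
      rcases abs_choice (t * y) with h | h <;> rw [h] <;>
        linarith [Real.exp_pos (t * y), Real.exp_pos (-(t * y))]
    have h3 : ((2 * M).factorial : ℝ) ≤ (2 * M : ℝ) ^ (2 * M) := by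
      exact_mod_cast Nat.factorial_le_pow (2 * M)
    calc _ ≤ Real.exp |t * y| * ((2 * M).factorial : ℝ) := h1
      _ ≤ (Real.exp (t * y) + Real.exp (-(t * y))) * (2 * M : ℝ) ^ (2 * M) := by gcongr
      _ = _ := mul_comm _ _
  have hexp : ∀ a : ℝ, a ^ 2 = 2 * M →
      ∑ e : Fin n → Bool, Real.exp (a * ∑ i, boolSign (e i) * x i) ≤ 2 ^ n * Real.exp 1 ^ M := by
    intro a ha
    have h := sum_exp_sign_sum_le fun i => a * x i
    have h1 : (∑ i, (a * x i) ^ 2) / 2 = M := by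
      simp only [mul_pow, ← Finset.mul_sum, hx, ha]
      ring
    rw [h1] at h
    rw [← Real.exp_nat_mul, mul_one]
    refine le_of_eq_of_le (Finset.sum_congr rfl fun e _ => ?_) h
    rw [Finset.mul_sum]
    congr 1
    exact Finset.sum_congr rfl fun i _ => by ring
  have hsum : (2 * M : ℝ) ^ M * ∑ e : Fin n → Bool, (∑ i, boolSign (e i) * x i) ^ (2 * M)
      ≤ (2 * M : ℝ) ^ M * (2 ^ n * (2 * (2 * M * Real.exp 1) ^ M)) := by
    calc _ = ∑ e : Fin n → Bool, (t * ∑ i, boolSign (e i) * x i) ^ (2 * M) := by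
          simp only [mul_pow, ht2M, ← Finset.mul_sum]
      _ ≤ ∑ e : Fin n → Bool, (2 * M : ℝ) ^ (2 * M) *
            (Real.exp (t * ∑ i, boolSign (e i) * x i)
              + Real.exp (-t * ∑ i, boolSign (e i) * x i)) := by
          refine Finset.sum_le_sum fun e _ => ?_
          rw [neg_mul]
          exact hone _
      _ ≤ (2 * M : ℝ) ^ (2 * M) * (2 ^ n * Real.exp 1 ^ M + 2 ^ n * Real.exp 1 ^ M) := by
          rw [← Finset.mul_sum, Finset.sum_add_distrib]
          gcongr
          · exact hexp t ht2
          · exact hexp (-t) (by rw [neg_sq, ht2])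
      _ = _ := by
          rw [two_mul M, pow_add, mul_pow _ (Real.exp 1)]
          ring
  exact le_of_mul_le_mul_left hsum (by positivity)

/-- Young's inequality for integral exponents. -/
theorem young_pow {a b : ℝ} (ha : 0 ≤ a) (hb : 0 ≤ b) (j : ℕ) :
    (j + 1) * (a ^ j * b) ≤ j * a ^ (j + 1) + b ^ (j + 1) := by
  induction j with
  | zero => simp
  | succ j ih =>
    have h : 0 ≤ (a - b) * (a ^ (j + 1) - b ^ (j + 1)) := by
      rcases le_total a b with h | h
      · exact mul_nonneg_of_nonpos_of_nonpos (sub_nonpos.2 h)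
          (sub_nonpos.2 (pow_le_pow_left₀ ha h _))
      · exact mul_nonneg (sub_nonneg.2 h) (sub_nonneg.2 (pow_le_pow_left₀ hb h _))
    push_cast
    have h2 := mul_le_mul_of_nonneg_left ih ha
    ring_nf at h h2 ⊢
    linarith

/-! ### Forms -/

noncomputable section

variable {n d : ℕ}

theorem sum_sq_coord (v : UnitSphere n) : ∑ i, (v : EuclideanSpace ℝ (Fin n)) i ^ 2 = 1 := by
  have h := EuclideanSpace.real_norm_sq_eq (v : EuclideanSpace ℝ (Fin n))
  rw [← h, mem_sphere_zero_iff_norm.1 v.2, one_pow]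

theorem evalAt_radial (v : UnitSphere n) : evalAt (radial n d) v = 1 := by
  simp [evalAt, radial, sum_sq_coord]

/-- Evaluation at a point of the sphere. -/
def evalLin (v : UnitSphere n) : Form n d →ₗ[ℝ] ℝ where
  toFun f := evalAt f v
  map_add' f g := evalAt_add f g v
  map_smul' a f := evalAt_smul a f v

theorem integrable_evalAt (hn : 1 ≤ n) (f : Form n d) :
    Integrable (evalAt f) (sphereUniform n) :=
  integrable_of_continuous hn (continuous_evalAt f)

/-- The mean over the sphere. -/
def meanLin (hn : 1 ≤ n) : Form n d →ₗ[ℝ] ℝ where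
  toFun f := ∫ v, evalAt f v ∂(sphereUniform n)
  map_add' f g := by
    simp only [evalAt_add]
    exact integral_add (integrable_evalAt hn f) (integrable_evalAt hn g)
  map_smul' a f := by
    simp only [evalAt_smul, integral_const_mul, smul_eq_mul, RingHom.id_apply]

theorem meanLin_radial (hn : 1 ≤ n) : meanLin hn (radial n d) = 1 := by
  have := isProbabilityMeasure_sphereUniform n hn
  simp [meanLin, evalAt_radial]

theorem meanLin_nonneg (hn : 1 ≤ n) {f : Form n d} (hf : f ∈ posCone n d) :
    0 ≤ meanLin hn f :=
  integral_nonneg hf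

/-- The form `(±x₁ ± ⋯ ± xₙ)^{2d}` with the given signs. -/
def signForm (d : ℕ) (e : Fin n → Bool) : Form n d :=
  ⟨(∑ i : Fin n, MvPolynomial.C (boolSign (e i)) * MvPolynomial.X i) ^ (2 * d),
    (MvPolynomial.mem_homogeneousSubmodule _ _).2 <| by
      have h := (MvPolynomial.IsHomogeneous.sum Finset.univ
        (fun i : Fin n => (MvPolynomial.C (boolSign (e i)) * MvPolynomial.X i :
          MvPolynomial (Fin n) ℝ)) 1
        (fun i _ => MvPolynomial.isHomogeneous_C_mul_X _ i)).pow (2 * d)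
      rwa [one_mul] at h⟩

theorem evalAt_signForm (e : Fin n → Bool) (v : UnitSphere n) :
    evalAt (signForm d e) v
      = (∑ i, boolSign (e i) * (v : EuclideanSpace ℝ (Fin n)) i) ^ (2 * d) := by
  simp [evalAt, signForm]

theorem signForm_mem_posCone (e : Fin n → Bool) : signForm d e ∈ posCone n d := fun v => by
  rw [evalAt_signForm]
  exact (even_two_mul d).pow_nonneg _

/-- The point is the sign vector divided by √n, where the linear form equals √n. -/
theorem exists_evalAt_signForm_eq (hn : 1 ≤ n) (e : Fin n → Bool) :
    ∃ v : UnitSphere n, evalAt (signForm d e) v = (n : ℝ) ^ d := by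
  have hn0 : (0 : ℝ) < n := by exact_mod_cast hn
  have hsq : ∀ b, boolSign b * boolSign b = 1 := by intro b; cases b <;> simp [boolSign]
  have hs0 : Real.sqrt n ≠ 0 := (Real.sqrt_pos.2 hn0).ne'
  refine ⟨⟨WithLp.toLp 2 fun i => (Real.sqrt n)⁻¹ * boolSign (e i), ?_⟩, ?_⟩
  · rw [mem_sphere_zero_iff_norm, EuclideanSpace.norm_eq, Real.sqrt_eq_one]
    simp only [Real.norm_eq_abs, sq_abs, mul_pow, sq (boolSign _), hsq, inv_pow,
      Real.sq_sqrt hn0.le]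
    simp [hn0.ne']
  · rw [evalAt_signForm]
    have : ∀ i, boolSign (e i) * ((Real.sqrt n)⁻¹ * boolSign (e i)) = (Real.sqrt n)⁻¹ := by
      intro i
      rw [mul_left_comm, hsq, mul_one]
    simp only [this, Finset.sum_const, Finset.card_univ, Fintype.card_fin, nsmul_eq_mul]
    rw [pow_mul]
    congr 1
    field_simp
    rw [Real.sq_sqrt hn0.le]

/-! ### Moment bounds for positive functionals and the counting argument. -/

/-- Moments over the signs: a normalized positive functional does no better than point
evaluations. -/
theorem sum_pow_signForm_le (L : Form n d →ₗ[ℝ] ℝ) (hL : ∀ f ∈ posCone n d, 0 ≤ L f)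
    (hL1 : L (radial n d) = 1) {k : ℕ} (hk : 1 ≤ k) (hd : 1 ≤ d) :
    ∑ e : Fin n → Bool, L (signForm d e) ^ k
      ≤ 2 ^ n * (2 * (2 * (d * k : ℕ) * Real.exp 1) ^ (d * k)) := by
  obtain ⟨j, rfl⟩ := Nat.exists_eq_add_of_le' hk
  set C : ℝ := 2 ^ n * (2 * (2 * (d * (j + 1) : ℕ) * Real.exp 1) ^ (d * (j + 1))) with hC
  set M := ∑ e : Fin n → Bool, L (signForm d e) ^ (j + 1) with hM
  -- With k = j + 1, Young's inequality for a = L(q_e), b = q_e(v), summed over e, shows that this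
  -- form is nonnegative on the sphere. Applying L gives jM + C - (j + 1)M ≥ 0, that is M ≤ C.
  have hpos := hL ((j * M + C) • radial n d
    - ((j : ℝ) + 1) • ∑ e : Fin n → Bool, L (signForm d e) ^ j • signForm d e) ?_
  · simp only [map_sub, map_smul, hL1, map_sum, smul_eq_mul, mul_one, ← pow_succ] at hpos
    rw [← hM] at hpos
    linarith
  · intro v
    have hsum : ∑ e : Fin n → Bool, evalAt (signForm d e) v ^ (j + 1) ≤ C := by
      have h := sum_sign_sum_pow_le (M := d * (j + 1)) (Nat.mul_pos hd hk) _ (sum_sq_coord v)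
      simp only [evalAt_signForm, ← pow_mul, mul_assoc 2 d (j + 1)]
      exact h
    have hval : evalLin v ((j * M + C) • radial n d
        - ((j : ℝ) + 1) • ∑ e : Fin n → Bool, L (signForm d e) ^ j • signForm d e)
        = j * M + C - ∑ e : Fin n → Bool,
          ((j : ℝ) + 1) * (L (signForm d e) ^ j * evalAt (signForm d e) v) := by
      have h1 : ∀ f : Form n d, evalLin v f = evalAt f v := fun _ => rfl
      simp only [map_sub, map_smul, map_sum, smul_eq_mul, Finset.mul_sum]
      simp only [h1, evalAt_radial, mul_one]
    change 0 ≤ evalLin v _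
    rw [hval, sub_nonneg]
    calc _ ≤ ∑ e : Fin n → Bool,
          (j * L (signForm d e) ^ (j + 1) + evalAt (signForm d e) v ^ (j + 1)) :=
        Finset.sum_le_sum fun e _ => young_pow (hL _ (signForm_mem_posCone e))
          (signForm_mem_posCone e v) j
      _ ≤ _ := by
        rw [Finset.sum_add_distrib, ← Finset.mul_sum]
        gcongr

/-- For each e, the sum of the k-th powers over the family dominates its largest term, hence B^k.
Summing over e and exchanging the sums brings in the moment bound once per member. -/
theorem pow_card_bound {α : Type*} (S : Finset α) (L : α → Form n d →ₗ[ℝ] ℝ)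
    (hL : ∀ i ∈ S, ∀ f ∈ posCone n d, 0 ≤ L i f) (hL1 : ∀ i ∈ S, L i (radial n d) = 1)
    {B : ℝ} (hB : 0 ≤ B) (hcov : ∀ e : Fin n → Bool, ∃ i ∈ S, B ≤ L i (signForm d e))
    {k : ℕ} (hk : 1 ≤ k) (hd : 1 ≤ d) :
    B ^ k ≤ S.card * (2 * (2 * (d * k : ℕ) * Real.exp 1) ^ (d * k)) := by
  have h : 2 ^ n * B ^ k
      ≤ 2 ^ n * (S.card * (2 * (2 * (d * k : ℕ) * Real.exp 1) ^ (d * k))) := by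
    calc 2 ^ n * B ^ k = ∑ e : Fin n → Bool, B ^ k := by simp
      _ ≤ ∑ e : Fin n → Bool, ∑ i ∈ S, L i (signForm d e) ^ k := by
        refine Finset.sum_le_sum fun e _ => ?_
        obtain ⟨i, hi, hBi⟩ := hcov e
        exact (pow_le_pow_left₀ hB hBi k).trans (Finset.single_le_sum
          (f := fun i => L i (signForm d e) ^ k)
          (fun i hi => pow_nonneg (hL i hi _ (signForm_mem_posCone e)) k) hi)
      _ = ∑ i ∈ S, ∑ e : Fin n → Bool, L i (signForm d e) ^ k := Finset.sum_comm
      _ ≤ ∑ i ∈ S, 2 ^ n * (2 * (2 * (d * k : ℕ) * Real.exp 1) ^ (d * k)) :=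
        Finset.sum_le_sum fun i hi => sum_pow_signForm_le (L i) (hL i hi) (hL1 i hi) hk hd
      _ = _ := by
        rw [Finset.sum_const, nsmul_eq_mul]
        ring
  exact le_of_mul_le_mul_left h (by positivity)

/-- A family of normalized positive functionals, one of which is at least `(n/c)^d` at each form
`(±x₁ ± ⋯ ± xₙ)^{2d}`, is exponentially large in `n/(cd)`. -/
theorem exp_le_card (hn : 1 ≤ n) (hd : 1 ≤ d) {c : ℝ} (hc : 1 < c) {α : Type*} (S : Finset α)
    (L : α → Form n d →ₗ[ℝ] ℝ)
    (hL : ∀ i ∈ S, ∀ f ∈ posCone n d, 0 ≤ L i f) (hL1 : ∀ i ∈ S, L i (radial n d) = 1)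
    (hcov : ∀ e : Fin n → Bool, ∃ i ∈ S, (n / c : ℝ) ^ d ≤ L i (signForm d e)) :
    1 / (2 * Real.exp 1) * Real.exp (1 / (2 * Real.exp 1 ^ 2) * (n / (c * d))) ≤ S.card := by
  have hE : (0 : ℝ) < Real.exp 1 := Real.exp_pos 1
  have hc0 : 0 < c := by linarith
  have hn0 : (0 : ℝ) < n := by exact_mod_cast hn
  have hd0 : (0 : ℝ) < d := by exact_mod_cast hd
  set x : ℝ := 1 / (2 * Real.exp 1 ^ 2) * (n / (c * d)) with hx
  have hx0 : 0 ≤ x := by positivity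
  -- Rounding x down costs a factor exp 1 and the moment bound a factor 2, whence the constant
  -- 1/(2·exp 1).
  suffices h : Real.exp (⌊x⌋₊ : ℝ) ≤ 2 * S.card by
    have h1 : Real.exp x ≤ Real.exp (⌊x⌋₊ : ℝ) * Real.exp 1 := by
      rw [← Real.exp_add]
      exact Real.exp_le_exp.2 (Nat.lt_floor_add_one x).le
    rw [one_div, inv_mul_le_iff₀ (by positivity)]
    nlinarith
  -- The moment bound needs k ≥ 1; for k = 0 it is enough that the family is nonempty.
  rcases Nat.eq_zero_or_pos ⌊x⌋₊ with h0 | hk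
  · obtain ⟨i, hi, -⟩ := hcov fun _ => true
    have : (1 : ℝ) ≤ S.card := by exact_mod_cast Finset.card_pos.2 ⟨i, hi⟩
    rw [h0]
    simp
    linarith
  · set k := ⌊x⌋₊ with hk_def
    have hkx : (k : ℝ) ≤ x := Nat.floor_le hx0
    have hb := pow_card_bound S L hL hL1 (by positivity) hcov hk hd
    rw [← pow_mul] at hb
    set y : ℝ := 2 * (d * k : ℕ) * Real.exp 1 with hy
    have hk0 : (0 : ℝ) < k := by exact_mod_cast hk
    have hy0 : 0 < y := by
      rw [hy]; push_cast; positivity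
    -- The factor 1/(2(exp 1)²) in x is chosen for this: each of the dk factors n/c then exceeds y
    -- by a factor exp 1, which leaves (exp 1)^{dk} ≤ 2|S|.
    have hyn : y * Real.exp 1 ≤ n / c := by
      rw [hx] at hkx
      rw [hy]
      push_cast
      calc _ = 2 * d * Real.exp 1 ^ 2 * k := by ring
        _ ≤ 2 * d * Real.exp 1 ^ 2 * (1 / (2 * Real.exp 1 ^ 2) * (n / (c * d))) := by gcongr
        _ = n / c := by field_simp
    have h1 : y ^ (d * k) * Real.exp 1 ^ (d * k) ≤ y ^ (d * k) * (2 * S.card) := by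
      calc _ = (y * Real.exp 1) ^ (d * k) := (mul_pow _ _ _).symm
        _ ≤ (n / c) ^ (d * k) := by gcongr
        _ ≤ _ := hb
        _ = _ := by ring
    have h2 := le_of_mul_le_mul_left h1 (by positivity)
    refine le_trans ?_ h2
    rw [← Real.exp_nat_mul, mul_one]
    refine Real.exp_le_exp.2 ?_
    exact_mod_cast Nat.le_mul_of_pos_left k hd

end

end NonnegForms

/-! ### From facets and vertices to positive functionals. -/

namespace NonnegForms

noncomputable section

variable {n d : ℕ}

/-- The functional `f ↦ ∫ f + φ (f - (∫ f) r)`. -/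
def liftFunctional (hn : 1 ≤ n) (φ : Form n d →ₗ[ℝ] ℝ) : Form n d →ₗ[ℝ] ℝ :=
  meanLin hn + φ.comp (LinearMap.id - (meanLin hn).smulRight (radial n d))

theorem liftFunctional_apply (hn : 1 ≤ n) (φ : Form n d →ₗ[ℝ] ℝ) (f : Form n d) :
    liftFunctional hn φ f = meanLin hn f + φ (f - meanLin hn f • radial n d) := by
  simp [liftFunctional]

theorem liftFunctional_radial (hn : 1 ≤ n) (φ : Form n d →ₗ[ℝ] ℝ) :
    liftFunctional hn φ (radial n d) = 1 := by
  simp [liftFunctional_apply, meanLin_radial]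

/-- The mean is nonnegative and c^d ≥ 1, so adding back the full mean more than repays the mean
divided by c^d. -/
theorem le_liftFunctional_signForm (hn : 1 ≤ n) {c : ℝ} (hc : 1 < c) (φ : Form n d →ₗ[ℝ] ℝ)
    (e : Fin n → Bool)
    (h : ((n : ℝ) ^ d - meanLin hn (signForm d e)) / c ^ d
      ≤ φ (signForm d e - meanLin hn (signForm d e) • radial n d)) :
    (n / c : ℝ) ^ d ≤ liftFunctional hn φ (signForm d e) := by
  have hI := meanLin_nonneg hn (signForm_mem_posCone (d := d) e)
  have hcd : 1 ≤ c ^ d := one_le_pow₀ hc.le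
  rw [liftFunctional_apply, div_pow]
  rw [sub_div] at h
  linarith [div_le_self hI hcd]

/-! ### The base of the cone -/

theorem exists_smul_mem_posBase_sub (hn : 1 ≤ n) {f : Form n d} (hf : meanLin hn f = 0) :
    ∃ t : ℝ, 0 < t ∧ t • f ∈ posBase n d - {radial n d} := by
  obtain ⟨M, hM⟩ := (isCompact_range (continuous_evalAt f)).isBounded.exists_norm_le
  have hM' : ∀ v, -(|M| + 1) ≤ evalAt f v := fun v => by
    have := hM _ (Set.mem_range_self v)
    rw [Real.norm_eq_abs] at this
    linarith [neg_abs_le (evalAt f v), le_abs_self M]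
  have hpos : 0 < |M| + 1 := by positivity
  refine ⟨(|M| + 1)⁻¹, inv_pos.2 hpos, ?_⟩
  rw [Set.sub_singleton]
  refine ⟨(|M| + 1)⁻¹ • f + radial n d, ⟨fun v => ?_, ?_⟩, by simp⟩
  · rw [evalAt_add, evalAt_smul, evalAt_radial]
    have := mul_le_mul_of_nonneg_left (hM' v) (inv_pos.2 hpos).le
    rw [mul_neg, inv_mul_cancel₀ hpos.ne'] at this
    linarith
  · change meanLin hn _ = 1
    rw [map_add, map_smul, hf, meanLin_radial, smul_zero, zero_add]

theorem meanLin_eq_zero_of_mem (hn : 1 ≤ n) {c : ℝ} {f : Form n d}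
    (hf : f ∈ c • (posBase n d - {radial n d})) : meanLin hn f = 0 := by
  rw [Set.sub_singleton] at hf
  obtain ⟨_, ⟨g, hg, rfl⟩, rfl⟩ := hf
  have h1 : meanLin hn g = 1 := hg.2
  simp [h1, meanLin_radial]

theorem zero_mem_posBase_sub (hn : 1 ≤ n) : (0 : Form n d) ∈ posBase n d - {radial n d} := by
  obtain ⟨t, -, ht⟩ := exists_smul_mem_posBase_sub hn (f := (0 : Form n d)) (map_zero _)
  rwa [smul_zero] at ht

/-- A functional `≤ 1` on the base of the cone lifts to a positive functional. -/
theorem liftFunctional_neg_nonneg (hn : 1 ≤ n) {l : Form n d →ₗ[ℝ] ℝ}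
    (hl : ∀ f ∈ posBase n d - {radial n d}, l f ≤ 1) {f : Form n d} (hf : f ∈ posCone n d) :
    0 ≤ liftFunctional hn (-l) f := by
  have hpos : ∀ g ∈ posCone n d, 0 < meanLin hn g → 0 ≤ liftFunctional hn (-l) g := by
    intro g hg hI
    have h := hl ((meanLin hn g)⁻¹ • g - radial n d)
      (Set.sub_mem_sub ⟨fun v => ?_, ?_⟩ rfl)
    · rw [map_sub, map_smul, smul_eq_mul] at h
      rw [liftFunctional_apply]
      simp only [LinearMap.neg_apply, map_sub, map_smul, smul_eq_mul]
      have := mul_le_mul_of_nonneg_left h hI.le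
      rw [mul_sub, mul_inv_cancel_left₀ hI.ne'] at this
      linarith
    · rw [evalAt_smul]
      exact mul_nonneg (inv_pos.2 hI).le (hg v)
    · change meanLin hn _ = 1
      rw [map_smul, smul_eq_mul, inv_mul_cancel₀ hI.ne']
  -- Adding δr makes the mean positive, so that the form can be normalized; then δ tends to 0.
  refine le_of_forall_pos_le_add fun δ hδ => ?_
  have h := hpos (f + δ • radial n d) (fun v => ?_) ?_
  · simpa [liftFunctional_radial] using h
  · rw [evalAt_add, evalAt_smul, evalAt_radial]
    linarith [hf v]
  · rw [map_add, map_smul, meanLin_radial, smul_eq_mul]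
    linarith [meanLin_nonneg hn hf]

theorem exp_le_numFacets (hn : 1 ≤ n) (hd : 1 ≤ d) {c : ℝ} (hc : 1 < c) {K : Set (Form n d)}
    (hK : IsPolytope K) (hAK : posBase n d - {radial n d} ⊆ K)
    (hKA : K ⊆ c ^ d • (posBase n d - {radial n d})) :
    1 / (2 * Real.exp 1) * Real.exp (1 / (2 * Real.exp 1 ^ 2) * (n / (c * d)))
      ≤ numFacets K := by
  classical
  have hfin := finite_setOf_isFacet hK
  obtain ⟨s, rfl⟩ := hK
  set K := convexHull ℝ (s : Set (Form n d))
  have hcd : 0 < c ^ d := pow_pos (by linarith) d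
  have h0 : (0 : Form n d) ∈ K := hAK (zero_mem_posBase_sub hn)
  have hsK : ∀ x ∈ s, x ∈ K := fun x hx => subset_convexHull ℝ _ hx
  have habs : ∀ φ : Form n d →ₗ[ℝ] ℝ, (∀ x ∈ s, φ x ≤ 0) → ∀ x ∈ s, φ x = 0 := by
    intro φ hφ x hx
    refine le_antisymm (hφ x hx) ?_
    obtain ⟨t, ht, htx⟩ := exists_smul_mem_posBase_sub hn (f := -x)
      (by rw [map_neg, meanLin_eq_zero_of_mem hn (hKA (hsK x hx)), neg_zero])
    have h := le_of_mem_convexHull hφ (hAK htx)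
    rw [map_smul, map_neg, smul_eq_mul, mul_neg, neg_nonpos] at h
    exact nonneg_of_mul_nonneg_right h ht
  have hspan : ∀ f : Form n d, meanLin hn f = 0 →
      f ∈ Submodule.span ℝ (s : Set (Form n d)) := by
    intro f hf
    obtain ⟨t, ht, htf⟩ := exists_smul_mem_posBase_sub hn hf
    have h := convexHull_min Submodule.subset_span (Submodule.convex _) (hAK htf)
    exact (Submodule.smul_mem_iff _ ht.ne').1 h
  -- a functional that is valid on `K` and tight on a given facet
  let P : Set (Form n d) → (Form n d →ₗ[ℝ] ℝ) → Prop := fun F l =>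
    (∀ x ∈ K, l x ≤ 1) ∧ F = {x | x ∈ K ∧ l x = 1} ∧
      ∀ x ∈ s, x ∈ Submodule.span ℝ {x | x ∈ s ∧ l x = 1}
  -- The default 0 is still at most 1 on K, so every set F yields a positive functional.
  let lam : Set (Form n d) → (Form n d →ₗ[ℝ] ℝ) := fun F =>
    if h : ∃ l, P F l then h.choose else 0
  have hlam : ∀ F l, P F l → P F (lam F) := by
    intro F l h
    have hex : ∃ l, P F l := ⟨l, h⟩
    simp only [lam, dif_pos hex]
    exact hex.choose_spec
  have hlam1 : ∀ F, ∀ x ∈ K, lam F x ≤ 1 := by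
    intro F x hx
    by_cases hex : ∃ l, P F l
    · obtain ⟨l, hl⟩ := hex
      exact (hlam F l hl).1 x hx
    · simp [lam, dif_neg hex]
  have hcard : numFacets K = hfin.toFinset.card := Set.ncard_eq_toFinset_card _ hfin
  rw [hcard]
  refine exp_le_card hn hd hc hfin.toFinset (fun F => liftFunctional hn (-lam F))
    (fun F _ f hf => liftFunctional_neg_nonneg hn (fun g hg => hlam1 F g (hAK hg)) hf)
    (fun F _ => liftFunctional_radial hn _) fun e => ?_
  obtain ⟨v, hv⟩ := exists_evalAt_signForm_eq (d := d) hn e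
  set q := signForm d e with hq
  -- At x = c^d(g - r) with g in the base, the value is 1 - g(v) ≤ 1.
  have hl₀ : ∀ x ∈ s, (-(c ^ d)⁻¹ • evalLin v) x ≤ 1 := by
    intro x hx
    have h := hKA (hsK x hx)
    rw [Set.sub_singleton] at h
    obtain ⟨_, ⟨g, hg, rfl⟩, rfl⟩ := h
    have h1 : evalLin v (radial n d) = 1 := evalAt_radial v
    have h2 : 0 ≤ evalLin v g := hg.1 v
    simp only [LinearMap.smul_apply, map_smul, map_sub, h1, smul_eq_mul]
    have h3 : c ^ d * (-((c ^ d)⁻¹ * evalLin v g) - -(c ^ d)⁻¹ * 1) = 1 - evalLin v g := by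
      field_simp
      ring
    linarith
  set y := q - meanLin hn q • radial n d with hy
  obtain ⟨l, hl1, hly, hlsp⟩ := exists_tight_span s habs (-y) _ hl₀
  set F := {x | x ∈ K ∧ l x = 1} with hF
  have hPl : P F l := ⟨fun x hx => le_of_mem_convexHull hl1 hx, rfl, hlsp⟩
  have hPF := hlam F l hPl
  -- The functional chosen for F need not be l, but both equal 1 on the tight generators. These span
  -- all mean-zero forms, including y.
  have hagree : lam F y = l y := by
    have hle : Submodule.span ℝ (s : Set (Form n d)) ≤ LinearMap.ker (lam F - l) := by
      rw [Submodule.span_le]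
      intro x hx
      refine Submodule.span_le.2 (fun z hz => ?_) (hlsp x hx)
      have hzF : z ∈ F := ⟨hsK z hz.1, hz.2⟩
      have hz1 : lam F z = 1 := by
        rw [hPF.2.1] at hzF
        exact hzF.2
      simp [hz1, hz.2]
    have h := hle (hspan y (by simp [hy, meanLin_radial]))
    rw [LinearMap.mem_ker, LinearMap.sub_apply] at h
    linarith
  refine ⟨F, by simpa using isFacet_of_tight_span s h0 hl1 hlsp, ?_⟩
  refine le_liftFunctional_signForm hn hc _ e ?_
  have hev : evalLin v y = (n : ℝ) ^ d - meanLin hn q := by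
    have h1 : evalLin v (radial n d) = 1 := evalAt_radial v
    have h2 : evalLin v q = (n : ℝ) ^ d := hv
    simp [hy, h1, h2]
  rw [← hq, ← hy, ← hev, LinearMap.neg_apply, hagree]
  rw [LinearMap.smul_apply, map_neg, map_neg, smul_eq_mul, neg_mul_neg] at hly
  rwa [div_eq_inv_mul]

/-! ### The body of point evaluations -/

/-- The inner product of the sphere as a linear functional in the first argument. -/
def innerLeft (hn : 1 ≤ n) (g : Form n d) : Form n d →ₗ[ℝ] ℝ where
  toFun f := sphereInner f g
  map_add' f f' := by
    simp only [sphereInner, evalAt_add, add_mul]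
    exact integral_add
      (integrable_of_continuous hn ((continuous_evalAt f).mul (continuous_evalAt g)))
      (integrable_of_continuous hn ((continuous_evalAt f').mul (continuous_evalAt g)))
  map_smul' a f := by
    simp only [sphereInner, evalAt_smul, mul_assoc, integral_const_mul, smul_eq_mul,
      RingHom.id_apply]

theorem sphereInner_comm (f g : Form n d) : sphereInner f g = sphereInner g f := by
  simp only [sphereInner, mul_comm]

theorem sphereInner_radial (hn : 1 ≤ n) (f : Form n d) :
    sphereInner f (radial n d) = meanLin hn f := by
  simp [sphereInner, evalAt_radial, meanLin]

theorem sphereInner_evalForm_sub (hn : 1 ≤ n) {v : UnitSphere n} {p : Form n d}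
    (hp : IsEvalForm v p) (f : Form n d) :
    innerLeft hn f (p - radial n d) = evalAt f v - meanLin hn f := by
  rw [map_sub]
  change sphereInner p f - sphereInner (radial n d) f = _
  rw [sphereInner_comm, hp f, sphereInner_comm, sphereInner_radial hn]

/-- At a generator p_v - r the inner product is f(v) - ∫f, and f(v) ≥ 0. This gives the positivity
of the functionals lifted from vertices. -/
theorem neg_meanLin_le_of_mem_evalBody (hn : 1 ≤ n) {f g : Form n d} (hf : f ∈ posCone n d)
    (hg : g ∈ evalBody n d) : -meanLin hn f ≤ innerLeft hn f g := by
  have h := le_of_mem_convexHull (l := -innerLeft hn f) (b := meanLin hn f) ?_ hg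
  · rw [LinearMap.neg_apply] at h
    linarith
  · rintro _ ⟨v, p, hp, rfl⟩
    rw [LinearMap.neg_apply, sphereInner_evalForm_sub hn hp]
    linarith [hf v]

theorem meanLin_eq_zero_of_mem_evalBody (hn : 1 ≤ n) {g : Form n d} (hg : g ∈ evalBody n d) :
    meanLin hn g = 0 := by
  have h := convexHull_min (t := LinearMap.ker (meanLin (d := d) hn)) ?_ (Submodule.convex _) hg
  · exact h
  · rintro _ ⟨v, p, hp, rfl⟩
    have h1 := hp (radial n d)
    rw [sphereInner_comm, sphereInner_radial hn, evalAt_radial] at h1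
    simp [h1, meanLin_radial]

theorem exp_le_numVertices (hn : 1 ≤ n) (hd : 1 ≤ d) {c : ℝ} (hc : 1 < c)
    {S : Set (Form n d)} (hS : S.Finite) (hBP : evalBody n d ⊆ convexHull ℝ S)
    (hPB : convexHull ℝ S ⊆ c ^ d • evalBody n d) :
    1 / (2 * Real.exp 1) * Real.exp (1 / (2 * Real.exp 1 ^ 2) * (n / (c * d)))
      ≤ numVertices (convexHull ℝ S) := by
  have hcd : 0 < c ^ d := pow_pos (by linarith) d
  have hfin : (Set.extremePoints ℝ (convexHull ℝ S)).Finite :=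
    hS.subset extremePoints_convexHull_subset
  have hcard : numVertices (convexHull ℝ S) = hfin.toFinset.card :=
    Set.ncard_eq_toFinset_card _ hfin
  rw [hcard]
  refine exp_le_card hn hd hc hfin.toFinset
    (fun g => liftFunctional hn ((c ^ d)⁻¹ • innerLeft hn g)) (fun g hg f hf => ?_)
    (fun F _ => liftFunctional_radial hn _) fun e => ?_
  · obtain ⟨b, hb, rfl⟩ := hPB (extremePoints_subset (hfin.mem_toFinset.1 hg))
    have h1 := neg_meanLin_le_of_mem_evalBody hn hf hb
    have h2 : innerLeft hn b (radial n d) = 0 := by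
      rw [← meanLin_eq_zero_of_mem_evalBody hn hb, ← sphereInner_radial hn, sphereInner_comm]
      rfl
    have h3 : ∀ f, innerLeft hn (c ^ d • b) f = c ^ d * innerLeft hn b f := fun f => by
      change sphereInner f _ = c ^ d * sphereInner f b
      rw [sphereInner_comm, sphereInner_comm f]
      exact map_smul (innerLeft hn f) _ _
    have h4 : innerLeft hn b f = innerLeft hn f b := sphereInner_comm _ _
    rw [liftFunctional_apply, LinearMap.smul_apply, h3, smul_eq_mul,
      inv_mul_cancel_left₀ hcd.ne', map_sub, map_smul, h2, smul_zero, sub_zero, h4]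
    linarith
  · obtain ⟨v, hv⟩ := exists_evalAt_signForm_eq (d := d) hn e
    obtain ⟨p, hp, -⟩ := existsUnique_evalForm (d := d) hn v
    have hmem : p - radial n d
        ∈ convexHull ℝ (Set.extremePoints ℝ (convexHull ℝ S)) := by
      rw [convexHull_extremePoints_of_finite hS]
      exact hBP (subset_convexHull ℝ _ ⟨v, p, hp, rfl⟩)
    set q := signForm d e with hq
    set y := q - meanLin hn q • radial n d with hy
    -- Pairing with y takes this value at p_v - r, a point of P, so some vertex of P attains at
    -- least as much.
    have hval : (n : ℝ) ^ d - meanLin hn q ≤ innerLeft hn y (p - radial n d) := by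
      rw [sphereInner_evalForm_sub hn hp, hy]
      have h1 : evalLin v (q - meanLin hn q • radial n d) = (n : ℝ) ^ d - meanLin hn q := by
        have h1 : evalLin v (radial n d) = 1 := evalAt_radial v
        have h2 : evalLin v q = (n : ℝ) ^ d := hv
        simp [h1, h2]
      have h2 : meanLin hn (q - meanLin hn q • radial n d) = 0 := by simp [meanLin_radial]
      rw [h2, sub_zero]
      exact h1.ge
    obtain ⟨g, hg, hgy⟩ := exists_le_of_mem_convexHull hmem hval
    refine ⟨g, hfin.mem_toFinset.2 hg, le_liftFunctional_signForm hn hc _ e ?_⟩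
    have h4 : innerLeft hn g y = innerLeft hn y g := sphereInner_comm _ _
    rw [← hq, ← hy, LinearMap.smul_apply, h4, smul_eq_mul, div_eq_inv_mul]
    gcongr

theorem numVertices_range_le {N : ℕ} (f : Fin N → Form n d) :
    numVertices (convexHull ℝ (Set.range f)) ≤ N := by
  calc numVertices (convexHull ℝ (Set.range f)) ≤ (Set.range f).ncard :=
        Set.ncard_le_ncard extremePoints_convexHull_subset (Set.finite_range f)
    _ ≤ (Set.univ : Set (Fin N)).ncard := by
        rw [← Set.image_univ]
        exact Set.ncard_image_le
    _ = N := by simp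

end

end NonnegForms

theorem mainTheorem1 :
    ∃ a₀ a₁ : ℝ, 0 < a₀ ∧ 0 < a₁ ∧
      ∀ (n d : ℕ) (c : ℝ), 1 ≤ n → 1 ≤ d → 1 < c →
        (∀ K : Set (Form n d), IsPolytope K →
          posBase n d - {radial n d} ⊆ K →
          K ⊆ c ^ d • (posBase n d - {radial n d}) →
          a₀ * Real.exp (a₁ * ((n : ℝ) / (c * (d : ℝ)))) ≤ (numFacets K : ℝ)) ∧
        (∀ (N : ℕ) (f : Fin N → Form n d),
          evalBody n d ⊆ convexHull ℝ (Set.range f) →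
          convexHull ℝ (Set.range f) ⊆ c ^ d • evalBody n d →
          a₀ * Real.exp (a₁ * ((n : ℝ) / (c * (d : ℝ)))) ≤
              (numVertices (convexHull ℝ (Set.range f)) : ℝ) ∧
            a₀ * Real.exp (a₁ * ((n : ℝ) / (c * (d : ℝ)))) ≤ (N : ℝ)) := by
  refine ⟨1 / (2 * Real.exp 1), 1 / (2 * Real.exp 1 ^ 2), by positivity, by positivity,
    fun n d c hn hd hc => ⟨fun K hK h1 h2 => exp_le_numFacets hn hd hc hK h1 h2,
      fun N f h1 h2 => ?_⟩⟩
  have h := exp_le_numVertices hn hd hc (Set.finite_range f) h1 h2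
  exact ⟨h, h.trans (by exact_mod_cast numVertices_range_le f)⟩
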